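/- Let $K$ be a field, let $A=K[[x,y]]$ be the formal power series ring with maximal ideal $\mathfrak m=(x,y)$, and set $$I=(x^7,\;x^5y,\;x^4y^2,\;x^2y^6,\;y^{12}),\qquad f=x^7+x^4y^2+y^{12},\qquad g=x^5y+x^2y^6,\qquad Q=(f,g).$$ Let $\mathcal R(I)=A[It]\subseteq A[t]$ be the Rees algebra of $I$ and let $\mathcal F(I)=\mathcal R(I)/\mathfrak m\mathcal R(I)$ be its fiber cone. For $a\in I$ write $\overline{a}t$ for the image of $at\in\mathcal R(I)$ in $\mathcal F(I)$. Let $\varphi:K[X_1,\dots,X_5]\to\mathcal F(I)$ be the $K$-algebra homomorphism with $$\varphi(X_1)=\overline{f}t,\quad \varphi(X_2)=\overline{g}t,\quad \varphi(X_3)=\overline{x^7}t,\quad \varphi(X_4)=\overline{x^2y^6}t,\quad \varphi(X_5)=\overline{y^{12}}t.$$ Then the following hold. (i) $Q$ is a reduction of $I$ (that is, $Q\subseteq I$ and $I^{m+1}=QI^m$ for some $m>0$), with $I^2=QI+(x^4y^{12})$ and $I^3=QI^2$. (ii) $\mathfrak m I^2=\mathfrak m QI$, and $\mathcal F(I)$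 is a Cohen–Macaulay ring. (iii) $\operatorname{Ker}\varphi=(X_3^2-X_1X_3,\;X_3X_4,\;X_3X_5,\;X_4X_5-X_2X_5,\;X_5^2-X_1X_5,\;X_4^3+X_2^2X_4-2X_2X_4^2)$. -/

import Mathlib

/-- The fiber cone `F(I) = R(I) / 𝔪 R(I)` of an ideal `I` of a local ring `(A, 𝔪)`,
where `R(I) = A[It] ⊆ A[t]` is the Rees algebra of `I`. -/
abbrev FiberCone {A : Type*} [CommRing A] [IsLocalRing A] (I : Ideal A) : Type _ :=
  reesAlgebra I ⧸ (IsLocalRing.maximalIdeal A).map (algebraMap A (reesAlgebra I))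

/-- For `a ∈ I`, the class in `F(I)` of the element `a t ∈ R(I)`. -/
noncomputable def FiberCone.degOne {A : Type*} [CommRing A] [IsLocalRing A] (I : Ideal A)
    (a : I) : FiberCone I :=
  Ideal.Quotient.mk _ ⟨Polynomial.monomial 1 (a : A),
    reesAlgebra.monomial_mem.mpr (by rw [pow_one]; exact a.2)⟩

/-- Let `A` be a local `K`-algebra. Given `x i ∈ I`, this is the `K`-algebra homomorphism
`K[X i : i ∈ ι] → F(I)` that sends `X i` to the class of `(x i) t`. -/
noncomputable def FiberCone.presentation (K : Type*) [Field K] {A : Type*} [CommRing A]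
    [IsLocalRing A] [Algebra K A] (I : Ideal A) {ι : Type*} (x : ι → I) :
    MvPolynomial ι K →ₐ[K] FiberCone I :=
  MvPolynomial.aeval fun i => FiberCone.degOne I (x i)

/-- `Q` is a reduction of `I`: `Q ⊆ I` and `I ^ (m + 1) = Q I ^ m` for some `m > 0`. -/
def Ideal.IsReductionOf {A : Type*} [CommRing A] (Q I : Ideal A) : Prop :=
  Q ≤ I ∧ ∃ m : ℕ, 0 < m ∧ I ^ (m + 1) = Q * I ^ m

/-- A Noetherian local ring is Cohen-Macaulay if its maximal ideal contains a regular sequence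
whose length is the Krull dimension of the ring. -/
def IsCohenMacaulayLocalRing (R : Type*) [CommRing R] [IsLocalRing R] : Prop :=
  IsNoetherianRing R ∧ ∃ rs : List R, (∀ r ∈ rs, r ∈ IsLocalRing.maximalIdeal R) ∧
    RingTheory.Sequence.IsRegular R rs ∧ ((rs.length : ℕ∞) : WithBot ℕ∞) = ringKrullDim R

/-- A Noetherian ring is Cohen-Macaulay if all its localizations at maximal ideals are
Cohen-Macaulay local rings. -/
def IsCohenMacaulayRing (R : Type*) [CommRing R] : Prop :=
  IsNoetherianRing R ∧ ∀ (p : Ideal R) [p.IsMaximal],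
    IsCohenMacaulayLocalRing (Localization.AtPrime p)

namespace FiberConeExample

/-- The formal power series ring `A = K[[x, y]]`. -/
abbrev A (K : Type*) [Field K] : Type _ := MvPowerSeries (Fin 2) K

/-- The variable `x` of `K[[x, y]]`. -/
noncomputable abbrev x (K : Type*) [Field K] : A K := MvPowerSeries.X 0

/-- The variable `y` of `K[[x, y]]`. -/
noncomputable abbrev y (K : Type*) [Field K] : A K := MvPowerSeries.X 1

/-- The maximal ideal of `K[[x, y]]`. -/
noncomputable abbrev m (K : Type*) [Field K] : Ideal (A K) := IsLocalRing.maximalIdeal (A K)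

/-- The ideal `I = (x^7, x^5 y, x^4 y^2, x^2 y^6, y^12)`. -/
noncomputable def I (K : Type*) [Field K] : Ideal (A K) :=
  Ideal.span {x K ^ 7, x K ^ 5 * y K, x K ^ 4 * y K ^ 2, x K ^ 2 * y K ^ 6, y K ^ 12}

/-- The element `f = x^7 + x^4 y^2 + y^12`. -/
noncomputable def f (K : Type*) [Field K] : A K := x K ^ 7 + x K ^ 4 * y K ^ 2 + y K ^ 12

/-- The element `g = x^5 y + x^2 y^6`. -/
noncomputable def g (K : Type*) [Field K] : A K := x K ^ 5 * y K + x K ^ 2 * y K ^ 6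

/-- The ideal `Q = (f, g)`. -/
noncomputable def Q (K : Type*) [Field K] : Ideal (A K) := Ideal.span {f K, g K}

theorem x7_mem (K : Type*) [Field K] : x K ^ 7 ∈ I K := Ideal.subset_span (by simp)

theorem x5y_mem (K : Type*) [Field K] : x K ^ 5 * y K ∈ I K := Ideal.subset_span (by simp)

theorem x4y2_mem (K : Type*) [Field K] : x K ^ 4 * y K ^ 2 ∈ I K :=
  Ideal.subset_span (by simp)

theorem x2y6_mem (K : Type*) [Field K] : x K ^ 2 * y K ^ 6 ∈ I K :=
  Ideal.subset_span (by simp)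

theorem y12_mem (K : Type*) [Field K] : y K ^ 12 ∈ I K := Ideal.subset_span (by simp)

theorem f_mem (K : Type*) [Field K] : f K ∈ I K :=
  (I K).add_mem ((I K).add_mem (x7_mem K) (x4y2_mem K)) (y12_mem K)

theorem g_mem (K : Type*) [Field K] : g K ∈ I K := (I K).add_mem (x5y_mem K) (x2y6_mem K)

/-- The generators `f, g, x^7, x^2 y^6, y^12` of `I`. -/
noncomputable def gens (K : Type*) [Field K] : Fin 5 → I K :=
  ![⟨f K, f_mem K⟩, ⟨g K, g_mem K⟩, ⟨x K ^ 7, x7_mem K⟩, ⟨x K ^ 2 * y K ^ 6, x2y6_mem K⟩,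
    ⟨y K ^ 12, y12_mem K⟩]

/-- The homomorphism `φ : K[X₁, …, X₅] → F(I)` that sends `X₁, …, X₅` to the classes of
`f t, g t, x^7 t, x^2 y^6 t, y^12 t`. The variable `Xᵢ` is `MvPolynomial.X (i - 1)`. -/
noncomputable def φ (K : Type*) [Field K] : MvPolynomial (Fin 5) K →ₐ[K] FiberCone (I K) :=
  FiberCone.presentation K (I K) (gens K)

end FiberConeExample

/-!
Write `a, b, c, d, e` for the monomial generators `x ^ 7, x ^ 5 * y, x ^ 4 * y ^ 2, x ^ 2 * y ^ 6,
y ^ 12` of `I`, so that `f = a + c + e` and `g = b + d`.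

The identities `I ^ 2 = Q I + (d ^ 2)`, `I ^ 3 = Q I ^ 2` and `m I ^ 2 = m Q I` come from finitely
many relations between products of the generators; the last two are checked modulo `m I ^ 3` and
modulo `m ^ 2 I ^ 2`, which suffices by Nakayama's lemma.

The fiber cone is a quotient by a monomial ideal: it is
`K[a, b, c, d, e] / (ac, ad, ae, be, ce, b ^ 2 * d)` (`ker_monomialPresentation`). The six relations
hold because each of these products is a nonunit times another product of as many generators.
There are no others: a product of `n` generators outside the monomial ideal is divisible by no
other product of `n` generators (`IsStandard.eq_of_exponent_le`), so its coefficient is a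
functional that kills `m I ^ n` and detects exactly that product. The linear change of variables
from `(a, b, c, d, e)` to `(f, g, a, d, e)` gives the kernel of `φ` (`ker_φ`).

For the Cohen-Macaulay property, the fiber cone is free over `K[f, g]` with basis
`1, a, d, e, d ^ 2`. The relations show that these elements span. They are independent because the
monomial ring has enough points over its components, which correspond to the edges `ab`, `bc`, `cd`,
`de` of the Newton polygon, the third with a nilpotent `b` (`linearIndependent_basisLift`). A finite
flat algebra over a polynomial ring in two variables is Cohen-Macaulay
(`isCohenMacaulayRing_of_finite_of_flat`).
-/

/-! ### Finite flat algebras over a polynomial ring in two variables -/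

open Polynomial Pointwise in
/-- Monic polynomials `p(X)` and `q(Y)`, one in each variable, form a regular sequence in
`K[X][Y]`: modulo `p(X)` the second one is still a monic polynomial in `Y`. -/
theorem Polynomial.isWeaklyRegular_pair {K : Type*} [Field K] {p q : K[X]} (hp : p.Monic)
    (hq : q.Monic) : RingTheory.Sequence.IsWeaklyRegular K[X][X] [C p, q.map C] := by
  rw [RingTheory.Sequence.isWeaklyRegular_cons_iff,
    RingTheory.Sequence.isWeaklyRegular_singleton_iff]
  refine ⟨(isRegular_iff_ne_zero.mpr (C_ne_zero.mpr hp.ne_zero)).left, ?_⟩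
  refine (isSMulRegular_quotient_iff_mem_of_smul_mem _ _).mpr fun r hr => ?_
  have key (s : K[X][X]) : s ∈ C p • (⊤ : Submodule K[X][X] K[X][X]) ↔
      s.map (Ideal.Quotient.mk (Ideal.span {p})) = 0 := by
    rw [← Submodule.ideal_span_singleton_smul, smul_eq_mul, Ideal.mul_top]
    have := Ideal.mem_map_C_iff (I := Ideal.span {p}) (f := s)
    rw [Ideal.map_span, Set.image_singleton] at this
    rw [this, Polynomial.ext_iff]
    simp only [coeff_map, coeff_zero, Ideal.Quotient.eq_zero_iff_mem]
  rw [key, smul_eq_mul, Polynomial.map_mul] at hr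
  rw [key]
  exact ((hq.map C).map _).mul_right_eq_zero_iff.mp hr

/-- An integral extension does not raise the Krull dimension. -/
theorem ringKrullDim_le_of_algebra_isIntegral (R S : Type*) [CommRing R] [CommRing S] [Algebra R S]
    [Algebra.IsIntegral R S] : ringKrullDim S ≤ ringKrullDim R :=
  Order.krullDim_le_of_strictMono (PrimeSpectrum.comap (algebraMap R S)) fun p q h => by
    obtain ⟨x, hx, hxp⟩ := Set.exists_of_ssubset (show (p.asIdeal : Set S) ⊂ q.asIdeal from h)
    exact Ideal.comap_lt_comap_of_integral_mem_sdiff h.le ⟨hx, hxp⟩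
      (Algebra.IsIntegral.isIntegral (R := R) x)

open Polynomial in
/-- In a finite algebra over `K[X][Y]`, a maximal ideal contains a monic polynomial in `X` and a
monic polynomial in `Y`, since its residue field is finite over `K` by Zariski's lemma. -/
theorem Ideal.IsMaximal.exists_monic_mem (K : Type*) [Field K] {F : Type*} [CommRing F]
    [Algebra K[X][X] F] [Module.Finite K[X][X] F] (P : Ideal F) [P.IsMaximal] :
    ∃ p q : K[X], p.Monic ∧ q.Monic ∧ algebraMap K[X][X] F (C p) ∈ P ∧
      algebraMap K[X][X] F (q.map C) ∈ P := by
  let : Algebra K F := ((algebraMap K[X][X] F).comp (C.comp C)).toAlgebra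
  have : IsScalarTower K K[X][X] F := IsScalarTower.of_algebraMap_eq fun _ => rfl
  have : Algebra.FiniteType K[X] K[X][X] := inferInstance
  have : Algebra.FiniteType K K[X][X] :=
    Algebra.FiniteType.trans (S := K[X]) inferInstance inferInstance
  have : Algebra.FiniteType K F := Algebra.FiniteType.trans (S := K[X][X]) this inferInstance
  let := Ideal.Quotient.field P
  have : Algebra.FiniteType K (F ⧸ P) :=
    Algebra.FiniteType.trans (S := F) inferInstance inferInstance
  have : Module.Finite K (F ⧸ P) := finite_of_finite_type_of_isJacobsonRing K (F ⧸ P)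
  let φ : K[X][X] →ₐ[K] F ⧸ P :=
    (Ideal.Quotient.mkₐ K P).comp (IsScalarTower.toAlgHom K K[X][X] F)
  have hφ (s : K[X][X]) : φ s = Ideal.Quotient.mk P (algebraMap K[X][X] F s) := rfl
  refine ⟨minpoly K (φ (C X)), minpoly K (φ X), minpoly.monic (Algebra.IsIntegral.isIntegral _),
    minpoly.monic (Algebra.IsIntegral.isIntegral _), ?_, ?_⟩
  · rw [← Ideal.Quotient.eq_zero_iff_mem, ← hφ]
    have h (p : K[X]) : φ (C p) = aeval (φ (C X)) p := by
      rw [aeval_algHom_apply]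
      congr 1
      exact DFunLike.congr_fun (algHom_ext (f := IsScalarTower.toAlgHom K K[X] K[X][X])
        (g := aeval (C X)) (by simp)) p
    rw [h, minpoly.aeval]
  · rw [← Ideal.Quotient.eq_zero_iff_mem, ← hφ]
    have h (p : K[X]) : φ (p.map C) = aeval (φ X) p := by
      rw [aeval_algHom_apply]
      congr 1
    rw [h, minpoly.aeval]

open Polynomial in
/-- A finite flat algebra over `K[X][Y]` is Cohen-Macaulay: a regular sequence of two elements of
`K[X][Y]` lying in a given maximal ideal stays regular by flatness, and finiteness bounds the
dimension by two. -/
theorem isCohenMacaulayRing_of_finite_of_flat (K : Type*) [Field K] (F : Type*) [CommRing F]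
    [Algebra K[X][X] F] [Module.Finite K[X][X] F] [Module.Flat K[X][X] F] :
    IsCohenMacaulayRing F := by
  have : IsNoetherianRing F := IsNoetherianRing.of_finite K[X][X] F
  refine ⟨this, fun P _ => ?_⟩
  have : IsNoetherianRing (Localization.AtPrime P) :=
    IsLocalization.isNoetherianRing P.primeCompl _ this
  refine ⟨this, ?_⟩
  obtain ⟨p, q, hp, hq, hpP, hqP⟩ := Ideal.IsMaximal.exists_monic_mem K P
  have hreg := ((Polynomial.isWeaklyRegular_pair hp hq).of_flat
    (S := F)).isRegular_of_isLocalization_of_mem (Localization.AtPrime P) P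
      (by simp only [List.map_cons, List.map_nil, List.mem_cons, List.not_mem_nil, or_false]
          rintro r (rfl | rfl) <;> assumption)
  refine ⟨_, ?_, hreg, ?_⟩
  · simp only [List.map_cons, List.map_nil, List.mem_cons, List.not_mem_nil, or_false]
    rintro r (rfl | rfl)
    · exact (IsLocalization.AtPrime.to_map_mem_maximal_iff _ P _).mpr hpP
    · exact (IsLocalization.AtPrime.to_map_mem_maximal_iff _ P _).mpr hqP
  · have hdim := ringKrullDim_add_length_eq_ringKrullDim_of_isRegular _ hreg
    have : Nontrivial (Localization.AtPrime P ⧸ Ideal.ofList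
        (([C p, q.map C].map (algebraMap K[X][X] F)).map
          (algebraMap F (Localization.AtPrime P)))) :=
      Ideal.Quotient.nontrivial_iff.mpr (by simpa using hreg.2.symm)
    have h0 := ringKrullDim_nonneg_of_nontrivial (R := Localization.AtPrime P ⧸ Ideal.ofList
        (([C p, q.map C].map (algebraMap K[X][X] F)).map
          (algebraMap F (Localization.AtPrime P))))
    apply le_antisymm
    · rw [← hdim]
      exact le_add_of_nonneg_left h0
    · rw [IsLocalization.AtPrime.ringKrullDim_eq_height P]
      refine Ideal.height_le_ringKrullDim_of_isPrime.trans
        ((ringKrullDim_le_of_algebra_isIntegral K[X][X] F).trans ?_)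
      rw [ringKrullDim_of_isNoetherianRing, ringKrullDim_of_isNoetherianRing,
        ringKrullDim_eq_zero_of_field]
      exact le_of_eq rfl

namespace FiberConeExample

/-! ### The ideals `I` and `Q` -/

open MvPowerSeries in
theorem mem_m_iff (K : Type*) [Field K] (h : A K) : h ∈ m K ↔ constantCoeff h = 0 := by
  rw [IsLocalRing.mem_maximalIdeal, mem_nonunits_iff, MvPowerSeries.isUnit_iff_constantCoeff,
    isUnit_iff_ne_zero, not_not]

theorem x_mem_m (K : Type*) [Field K] : x K ∈ m K := (mem_m_iff K _).mpr (by simp)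

theorem y_mem_m (K : Type*) [Field K] : y K ∈ m K := (mem_m_iff K _).mpr (by simp)

open MvPowerSeries in
theorem m_eq_span (K : Type*) [Field K] : m K = Ideal.span {x K, y K} := by
  refine le_antisymm (fun h hh => ?_) ?_
  · rw [mem_m_iff] at hh
    -- Split `h` into the terms divisible by `x` and the remaining ones.
    let h₁ : A K := fun n => if n 0 = 0 then 0 else coeff n h
    have hx : x K ∣ h₁ := X_dvd_iff.mpr fun n hn => if_pos hn
    have hy : y K ∣ h - h₁ := by
      refine X_dvd_iff.mpr fun n hn => ?_
      change coeff n h - (if n 0 = 0 then 0 else coeff n h) = 0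
      split_ifs with h0
      · have : n = 0 := by ext i; fin_cases i <;> assumption
        rw [this, sub_zero]
        exact hh
      · exact sub_self _
    rw [← add_sub_cancel h₁ h]
    exact add_mem (Ideal.mem_of_dvd _ hx (Ideal.subset_span (by simp)))
      (Ideal.mem_of_dvd _ hy (Ideal.subset_span (by simp)))
  · rw [Ideal.span_le]
    rintro _ (rfl | rfl)
    · exact x_mem_m K
    · exact y_mem_m K

theorem m_fg (K : Type*) [Field K] : (m K).FG := by
  rw [m_eq_span]
  exact Submodule.fg_span (Set.toFinite _)

theorem I_fg (K : Type*) [Field K] : (I K).FG := Submodule.fg_span (Set.toFinite _)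

theorem f_mem_Q (K : Type*) [Field K] : f K ∈ Q K := Ideal.subset_span (by simp)

theorem g_mem_Q (K : Type*) [Field K] : g K ∈ Q K := Ideal.subset_span (by simp)

theorem Q_le_I (K : Type*) [Field K] : Q K ≤ I K := by
  rw [Q, Ideal.span_le]
  rintro _ (rfl | rfl)
  · exact f_mem K
  · exact g_mem K

/-- Nakayama's lemma for ideals of `K[[x, y]]`. -/
theorem le_of_le_sup_m_mul {K : Type*} [Field K] {J N : Ideal (A K)} (hJ : J.FG)
    (h : J ≤ N ⊔ m K * J) : J ≤ N :=
  Submodule.le_of_le_smul_of_le_jacobson_bot hJ (IsLocalRing.maximalIdeal_le_jacobson _) h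

/-- The products of two generators of `I` vanish in any quotient of `K[[x, y]]` in which the
products of `f` and `g` with the generators and `x ^ 4 * y ^ 12` vanish. -/
theorem mul_eq_zero_of_relations {T : Type*} [CommRing T] {x y f g : T}
    (hf : f = x ^ 7 + x ^ 4 * y ^ 2 + y ^ 12) (hg : g = x ^ 5 * y + x ^ 2 * y ^ 6)
    (hu : IsUnit (1 - y ^ 3)) {S : Set T}
    (hS : S = {x ^ 7, x ^ 5 * y, x ^ 4 * y ^ 2, x ^ 2 * y ^ 6, y ^ 12})
    (hfS : ∀ s ∈ S, f * s = 0) (hgS : ∀ s ∈ S, g * s = 0) (hd : x ^ 4 * y ^ 12 = 0)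
    {s t : T} (hs : s ∈ S) (ht : t ∈ S) : s * t = 0 := by
  subst hS
  simp only [Set.mem_insert_iff, Set.mem_singleton_iff, forall_eq_or_imp, forall_eq] at hfS hgS
  obtain ⟨fa, fb, fc, fd, fe⟩ := hfS
  obtain ⟨ga, gb, gc, gd, ge⟩ := hgS
  rw [hf] at fa fb fc fd fe
  rw [hg] at ga gb gc gd ge
  have bd : (x ^ 5 * y) * (x ^ 2 * y ^ 6) = 0 := by linear_combination gd - hd
  have bb : (x ^ 5 * y) * (x ^ 5 * y) = 0 := by linear_combination gb - bd
  have be : (x ^ 5 * y) * y ^ 12 = 0 := by linear_combination x * y * hd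
  have ce : (x ^ 4 * y ^ 2) * y ^ 12 = 0 := by linear_combination y ^ 2 * hd
  have ac : x ^ 7 * (x ^ 4 * y ^ 2) = 0 := by linear_combination x * bb
  have ae : x ^ 7 * y ^ 12 = 0 := by linear_combination y ^ 5 * bd
  have aa : x ^ 7 * x ^ 7 = 0 := by linear_combination fa - ac - ae
  have ee : y ^ 12 * y ^ 12 = 0 := by linear_combination fe - ae - ce
  have de : (x ^ 2 * y ^ 6) * y ^ 12 = 0 := by linear_combination ge - be
  have cc : (x ^ 4 * y ^ 2) * (x ^ 4 * y ^ 2) = 0 := by linear_combination fc - ac - ce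
  have cd : (x ^ 4 * y ^ 2) * (x ^ 2 * y ^ 6) = 0 := hu.mul_right_eq_zero.mp <| by
    linear_combination gc - fb + be + ga - y ^ 3 * gc
  have bc : (x ^ 5 * y) * (x ^ 4 * y ^ 2) = 0 := by linear_combination gc - cd
  have ad : x ^ 7 * (x ^ 2 * y ^ 6) = 0 := by linear_combination y ^ 3 * bc
  have ab : x ^ 7 * (x ^ 5 * y) = 0 := by linear_combination ga - ad
  have dd : (x ^ 2 * y ^ 6) * (x ^ 2 * y ^ 6) = 0 := by linear_combination hd
  rcases hs with rfl | rfl | rfl | rfl | rfl <;> rcases ht with rfl | rfl | rfl | rfl | rfl <;>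
    first
      | assumption
      | rw [mul_comm]; assumption

theorem I_sq_eq (K : Type*) [Field K] :
    I K ^ 2 = Q K * I K + Ideal.span {x K ^ 4 * y K ^ 12} := by
  refine le_antisymm ?_ (sup_le ?_ ?_)
  · set N := Q K * I K + Ideal.span {x K ^ 4 * y K ^ 12} with hN
    have hQI {q s : A K} (hq : q ∈ Q K) (hs : s ∈ I K) : Ideal.Quotient.mk N (q * s) = 0 :=
      Ideal.Quotient.eq_zero_iff_mem.mpr (Ideal.mem_sup_left (Ideal.mul_mem_mul hq hs))
    rw [pow_two, I, Ideal.span_mul_span', Ideal.span_le]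
    rintro _ ⟨s, hs, t, ht, rfl⟩
    refine Ideal.Quotient.eq_zero_iff_mem.mp ?_
    simp only [map_mul]
    refine mul_eq_zero_of_relations (f := Ideal.Quotient.mk N (f K))
      (g := Ideal.Quotient.mk N (g K)) (x := Ideal.Quotient.mk N (x K))
      (y := Ideal.Quotient.mk N (y K)) (by simp [f]) (by simp [g]) ?_ (S := _ '' _)
      ?_ ?_ ?_ ?_ (Set.mem_image_of_mem _ hs) (Set.mem_image_of_mem _ ht)
    · have : IsUnit (1 - y K ^ 3) := by simp [MvPowerSeries.isUnit_iff_constantCoeff]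
      simpa using this.map (Ideal.Quotient.mk N)
    · simp [Set.image_insert_eq]
    · rintro _ ⟨s, hs, rfl⟩
      rw [← map_mul, hQI (f_mem_Q K) (Ideal.subset_span hs)]
    · rintro _ ⟨s, hs, rfl⟩
      rw [← map_mul, hQI (g_mem_Q K) (Ideal.subset_span hs)]
    · simp only [← map_pow, ← map_mul]
      exact Ideal.Quotient.eq_zero_iff_mem.mpr
        (Ideal.mem_sup_right (Ideal.mem_span_singleton_self _))
  · rw [pow_two]
    exact Ideal.mul_mono_left (Q_le_I K)
  · rw [Ideal.span_singleton_le_iff_mem, pow_two]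
    convert Ideal.mul_mem_mul (x2y6_mem K) (x2y6_mem K) using 1
    ring

/-- The products of the generators of `I` with `x ^ 4 * y ^ 12` vanish in any quotient of
`K[[x, y]]` in which the relevant elements of `Q * I ^ 2` and of `m * I ^ 3` vanish. -/
theorem mul_x4y12_eq_zero_of_relations {T : Type*} [CommRing T] {x y f g a b c d e : T}
    (hf : f = a + c + e) (hg : g = b + d)
    (ha : a = x ^ 7) (hb : b = x ^ 5 * y) (hc : c = x ^ 4 * y ^ 2) (hd : d = x ^ 2 * y ^ 6)
    (he : e = y ^ 12) (fbd : f * (b * d) = 0) (fdd : f * (d * d) = 0) (gbd : g * (b * d) = 0)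
    (gcd : g * (c * d) = 0) (gdd : g * (d * d) = 0) (yccc : y * (c * (c * c)) = 0)
    (yddd : y * (d * (d * d)) = 0) (ybbc : y * (b * (b * c)) = 0) :
    a * (d * d) = 0 ∧ b * (d * d) = 0 ∧ c * (d * d) = 0 ∧ d * (d * d) = 0 ∧ e * (d * d) = 0 := by
  have bbd : b * b * d = 0 := by
    have : b * b * d = y * (y * (c * (c * c))) := by subst hb hc hd; ring
    rw [this, yccc, mul_zero]
  have bdd : b * (d * d) = 0 := by rw [hg] at gbd; linear_combination gbd - bbd
  have ddd : d * (d * d) = 0 := by rw [hg] at gdd; linear_combination gdd - bdd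
  have bde : b * d * e = 0 := by
    have : b * d * e = x * (y * (d * (d * d))) := by subst hb hd he; ring
    rw [this, yddd, mul_zero]
  have abd : a * b * d = 0 := by
    have : a * b * d = y ^ 2 * (y * (b * (b * c))) := by subst ha hb hc hd; ring
    rw [this, ybbc, mul_zero]
  have bcd : b * c * d = 0 := by rw [hf] at fbd; linear_combination fbd - abd - bde
  have cdd : c * (d * d) = 0 := by rw [hg] at gcd; linear_combination gcd - bcd
  have add : a * (d * d) = 0 := by
    have : a * (d * d) = y ^ 3 * (b * c * d) := by subst ha hb hc hd; ring
    rw [this, bcd, mul_zero]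
  refine ⟨add, bdd, cdd, ddd, ?_⟩
  rw [hf] at fdd
  linear_combination fdd - add - cdd

theorem I_cube_eq (K : Type*) [Field K] : I K ^ 3 = Q K * I K ^ 2 := by
  refine le_antisymm (le_of_le_sup_m_mul ((I_fg K).pow) ?_) ?_
  · set N := Q K * I K ^ 2 ⊔ m K * I K ^ 3 with hN
    have hsq {s t : A K} (hs : s ∈ I K) (ht : t ∈ I K) : s * t ∈ I K ^ 2 := by
      rw [pow_two]
      exact Ideal.mul_mem_mul hs ht
    have hQ {q s t : A K} (hq : q ∈ Q K) (hs : s ∈ I K) (ht : t ∈ I K) :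
        Ideal.Quotient.mk N (q * (s * t)) = 0 :=
      Ideal.Quotient.eq_zero_iff_mem.mpr
        (Ideal.mem_sup_left (Ideal.mul_mem_mul hq (hsq hs ht)))
    have hy {r s t : A K} (hr : r ∈ I K) (hs : s ∈ I K) (ht : t ∈ I K) :
        Ideal.Quotient.mk N (y K * (r * (s * t))) = 0 := by
      refine Ideal.Quotient.eq_zero_iff_mem.mpr
        (Ideal.mem_sup_right (Ideal.mul_mem_mul (y_mem_m K) ?_))
      rw [pow_succ']
      exact Ideal.mul_mem_mul hr (hsq hs ht)
    conv_lhs => rw [pow_succ', I_sq_eq, mul_add, mul_left_comm, ← pow_two]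
    refine sup_le le_sup_left ?_
    rw [I, Ideal.span_mul_span', Ideal.span_le, Set.mul_singleton]
    have key := mul_x4y12_eq_zero_of_relations (T := A K ⧸ N)
      (f := Ideal.Quotient.mk N (f K)) (g := Ideal.Quotient.mk N (g K))
      (x := Ideal.Quotient.mk N (x K)) (y := Ideal.Quotient.mk N (y K))
      (a := Ideal.Quotient.mk N (x K ^ 7)) (b := Ideal.Quotient.mk N (x K ^ 5 * y K))
      (c := Ideal.Quotient.mk N (x K ^ 4 * y K ^ 2))
      (d := Ideal.Quotient.mk N (x K ^ 2 * y K ^ 6)) (e := Ideal.Quotient.mk N (y K ^ 12))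
      (by simp [f]) (by simp [g]) (by simp) (by simp) (by simp) (by simp) (by simp)
      (by simpa only [map_mul] using hQ (f_mem_Q K) (x5y_mem K) (x2y6_mem K))
      (by simpa only [map_mul] using hQ (f_mem_Q K) (x2y6_mem K) (x2y6_mem K))
      (by simpa only [map_mul] using hQ (g_mem_Q K) (x5y_mem K) (x2y6_mem K))
      (by simpa only [map_mul] using hQ (g_mem_Q K) (x4y2_mem K) (x2y6_mem K))
      (by simpa only [map_mul] using hQ (g_mem_Q K) (x2y6_mem K) (x2y6_mem K))
      (by simpa only [map_mul] using hy (x4y2_mem K) (x4y2_mem K) (x4y2_mem K))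
      (by simpa only [map_mul] using hy (x2y6_mem K) (x2y6_mem K) (x2y6_mem K))
      (by simpa only [map_mul] using hy (x5y_mem K) (x5y_mem K) (x4y2_mem K))
    rw [show x K ^ 4 * y K ^ 12 = x K ^ 2 * y K ^ 6 * (x K ^ 2 * y K ^ 6) by ring]
    simp only [← map_mul, Ideal.Quotient.eq_zero_iff_mem] at key
    obtain ⟨h₁, h₂, h₃, h₄, h₅⟩ := key
    rintro _ ⟨s, hs, rfl⟩
    change s * _ ∈ N
    clear_value N
    simp only [Set.mem_insert_iff, Set.mem_singleton_iff] at hs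
    rcases hs with rfl | rfl | rfl | rfl | rfl
    exacts [h₁, h₂, h₃, h₄, h₅]
  · rw [pow_succ' _ 2]
    exact Ideal.mul_mono_left (Q_le_I K)

/-- Both `x * (x ^ 4 * y ^ 12)` and `y * (x ^ 4 * y ^ 12)` vanish in any quotient of `K[[x, y]]` in
which the relevant elements of `m * Q * I` and of `m ^ 2 * I ^ 2` vanish. -/
theorem x_mul_x4y12_eq_zero_of_relations {T : Type*} [CommRing T] {x y f g a b c d e : T}
    (hf : f = a + c + e) (hg : g = b + d)
    (ha : a = x ^ 7) (hb : b = x ^ 5 * y) (hc : c = x ^ 4 * y ^ 2) (hd : d = x ^ 2 * y ^ 6)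
    (he : e = y ^ 12) (xgd : x * (g * d) = 0) (ygd : y * (g * d) = 0) (xfd : x * (f * d) = 0)
    (xge : x * (g * e) = 0) (yycc : y * (y * (c * c)) = 0) (xybc : x * (y * (b * c)) = 0)
    (yycd : y * (y * (c * d)) = 0) : x * (d * d) = 0 ∧ y * (d * d) = 0 := by
  have xbd : x * (b * d) = 0 := by
    have : x * (b * d) = y * (y * (y * (c * c))) := by subst hb hc hd; ring
    rw [this, yycc, mul_zero]
  have xad : x * (a * d) = 0 := by
    have : x * (a * d) = y ^ 2 * (x * (y * (b * c))) := by subst ha hb hc hd; ring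
    rw [this, xybc, mul_zero]
  have xbe : x * (b * e) = 0 := by
    have : x * (b * e) = y ^ 3 * (y * (y * (c * d))) := by subst hb hc hd he; ring
    rw [this, yycd, mul_zero]
  have ybd : y * (b * d) = x * (c * d) := by subst hb hc hd; ring
  rw [hg] at xgd ygd xge
  rw [hf] at xfd
  constructor
  · linear_combination xgd - xbd
  · linear_combination ygd - ybd - xfd + xad + xge - xbe

theorem m_mul_I_sq_eq (K : Type*) [Field K] : m K * I K ^ 2 = m K * Q K * I K := by
  refine le_antisymm (le_of_le_sup_m_mul ((m_fg K).mul (I_fg K).pow) ?_) ?_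
  · set N := m K * Q K * I K ⊔ m K * (m K * I K ^ 2) with hN
    have hQ {p q s : A K} (hp : p ∈ m K) (hq : q ∈ Q K) (hs : s ∈ I K) :
        Ideal.Quotient.mk N (p * (q * s)) = 0 := by
      refine Ideal.Quotient.eq_zero_iff_mem.mpr (Ideal.mem_sup_left ?_)
      rw [mul_assoc]
      exact Ideal.mul_mem_mul hp (Ideal.mul_mem_mul hq hs)
    have hm {p q s t : A K} (hp : p ∈ m K) (hq : q ∈ m K) (hs : s ∈ I K) (ht : t ∈ I K) :
        Ideal.Quotient.mk N (p * (q * (s * t))) = 0 := by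
      refine Ideal.Quotient.eq_zero_iff_mem.mpr
        (Ideal.mem_sup_right (Ideal.mul_mem_mul hp (Ideal.mul_mem_mul hq ?_)))
      rw [pow_two]
      exact Ideal.mul_mem_mul hs ht
    conv_lhs => rw [I_sq_eq, mul_add, ← mul_assoc]
    refine sup_le le_sup_left ?_
    rw [m_eq_span, Ideal.span_mul_span', Ideal.span_le, Set.mul_singleton]
    have key := x_mul_x4y12_eq_zero_of_relations (T := A K ⧸ N)
      (f := Ideal.Quotient.mk N (f K)) (g := Ideal.Quotient.mk N (g K))
      (x := Ideal.Quotient.mk N (x K)) (y := Ideal.Quotient.mk N (y K))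
      (a := Ideal.Quotient.mk N (x K ^ 7)) (b := Ideal.Quotient.mk N (x K ^ 5 * y K))
      (c := Ideal.Quotient.mk N (x K ^ 4 * y K ^ 2))
      (d := Ideal.Quotient.mk N (x K ^ 2 * y K ^ 6)) (e := Ideal.Quotient.mk N (y K ^ 12))
      (by simp [f]) (by simp [g]) (by simp) (by simp) (by simp) (by simp) (by simp)
      (by simpa only [map_mul] using hQ (x_mem_m K) (g_mem_Q K) (x2y6_mem K))
      (by simpa only [map_mul] using hQ (y_mem_m K) (g_mem_Q K) (x2y6_mem K))
      (by simpa only [map_mul] using hQ (x_mem_m K) (f_mem_Q K) (x2y6_mem K))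
      (by simpa only [map_mul] using hQ (x_mem_m K) (g_mem_Q K) (y12_mem K))
      (by simpa only [map_mul] using hm (y_mem_m K) (y_mem_m K) (x4y2_mem K) (x4y2_mem K))
      (by simpa only [map_mul] using hm (x_mem_m K) (y_mem_m K) (x5y_mem K) (x4y2_mem K))
      (by simpa only [map_mul] using hm (y_mem_m K) (y_mem_m K) (x4y2_mem K) (x2y6_mem K))
    rw [show x K ^ 4 * y K ^ 12 = x K ^ 2 * y K ^ 6 * (x K ^ 2 * y K ^ 6) by ring]
    simp only [← map_mul, Ideal.Quotient.eq_zero_iff_mem] at key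
    obtain ⟨h₁, h₂⟩ := key
    rintro _ ⟨s, rfl | rfl, rfl⟩ <;> assumption
  · rw [pow_two, mul_assoc]
    exact Ideal.mul_mono_right (Ideal.mul_mono_left (Q_le_I K))

/-! ### The fiber cone as a quotient by a monomial ideal -/

/-- The exponents of the five monomial generators of `I`. -/
noncomputable def genExponent : Fin 5 → Fin 2 →₀ ℕ :=
  ![.single 0 7, .single 0 5 + .single 1 1, .single 0 4 + .single 1 2,
    .single 0 2 + .single 1 6, .single 1 12]

/-- The exponent of the product of the monomial generators of `I`, the `i`-th one taken `u i`
times. -/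
noncomputable def exponent (u : Fin 5 →₀ ℕ) : Fin 2 →₀ ℕ := ∑ i, u i • genExponent i

theorem exponent_apply_zero (u : Fin 5 →₀ ℕ) :
    exponent u 0 = 7 * u 0 + 5 * u 1 + 4 * u 2 + 2 * u 3 := by
  simp [exponent, genExponent, Fin.sum_univ_five]
  ring

theorem exponent_apply_one (u : Fin 5 →₀ ℕ) :
    exponent u 1 = u 1 + 2 * u 2 + 6 * u 3 + 12 * u 4 := by
  simp [exponent, genExponent, Fin.sum_univ_five]
  ring

theorem exponent_add (u v : Fin 5 →₀ ℕ) : exponent (u + v) = exponent u + exponent v := by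
  simp [exponent, add_smul, Finset.sum_add_distrib]

theorem exponent_single (i : Fin 5) : exponent (.single i 1) = genExponent i := by
  simp [exponent, Finsupp.single_apply, ite_smul]

theorem degree_eq_sum_five (u : Fin 5 →₀ ℕ) : u.degree = u 0 + u 1 + u 2 + u 3 + u 4 := by
  rw [Finsupp.degree_eq_sum, Fin.sum_univ_five]

/-- The monomial generators `x ^ 7, x ^ 5 * y, x ^ 4 * y ^ 2, x ^ 2 * y ^ 6, y ^ 12` of `I`. -/
noncomputable def monomialGens (K : Type*) [Field K] : Fin 5 → I K :=
  ![⟨x K ^ 7, x7_mem K⟩, ⟨x K ^ 5 * y K, x5y_mem K⟩, ⟨x K ^ 4 * y K ^ 2, x4y2_mem K⟩,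
    ⟨x K ^ 2 * y K ^ 6, x2y6_mem K⟩, ⟨y K ^ 12, y12_mem K⟩]

theorem coe_monomialGens (K : Type*) [Field K] (i : Fin 5) :
    (monomialGens K i : A K) = MvPowerSeries.monomial (genExponent i) 1 := by
  have hy : y K = MvPowerSeries.monomial (.single 1 1) 1 := MvPowerSeries.X_def 1
  fin_cases i <;>
    simp [monomialGens, genExponent, MvPowerSeries.X_pow_eq, hy,
      MvPowerSeries.monomial_mul_monomial, MvPowerSeries.monomial_pow]

theorem I_eq_span_range (K : Type*) [Field K] :
    I K = Ideal.span (Set.range fun i => (monomialGens K i : A K)) := by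
  refine congrArg Ideal.span ?_
  ext z
  simp [Fin.exists_fin_succ, monomialGens, eq_comm]

/-- The `K`-algebra homomorphism from `K[X₁, …, X₅]` to the Rees algebra of `I` that sends the
variables to the monomial generators of `I`, placed in degree one. -/
noncomputable def toRees (K : Type*) [Field K] :
    MvPolynomial (Fin 5) K →ₐ[K] reesAlgebra (I K) :=
  MvPolynomial.aeval fun i => ⟨Polynomial.monomial 1 (monomialGens K i : A K),
    reesAlgebra.monomial_mem.mpr (by rw [pow_one]; exact (monomialGens K i).2)⟩

theorem toRees_X (K : Type*) [Field K] (i : Fin 5) :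
    (toRees K (MvPolynomial.X i) : Polynomial (A K)) =
      Polynomial.monomial 1 (monomialGens K i : A K) := by
  simp [toRees]

theorem toRees_C (K : Type*) [Field K] (c : K) :
    (toRees K (MvPolynomial.C c) : Polynomial (A K)) =
      Polynomial.C (MvPowerSeries.C c) := by
  rw [toRees, MvPolynomial.aeval_C]
  rfl

theorem toRees_monomial (K : Type*) [Field K] (u : Fin 5 →₀ ℕ) (c : K) :
    (toRees K (MvPolynomial.monomial u c) : Polynomial (A K)) =
      Polynomial.monomial u.degree (MvPowerSeries.monomial (exponent u) c) := by
  induction u using Finsupp.induction_linear generalizing c with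
  | zero =>
    change (toRees K (MvPolynomial.C c) : Polynomial (A K)) = _
    rw [toRees_C]
    simp [exponent, MvPowerSeries.monomial_zero_eq_C_apply]
  | add u v hu hv =>
    have : MvPolynomial.monomial (u + v) c =
        MvPolynomial.monomial u c * MvPolynomial.monomial v 1 := by simp
    rw [this, map_mul, MulMemClass.coe_mul, hu, hv, Polynomial.monomial_mul_monomial,
      MvPowerSeries.monomial_mul_monomial, exponent_add, mul_one, map_add]
  | single i n =>
    rw [← MvPolynomial.C_mul_X_pow_eq_monomial, map_mul, map_pow, MulMemClass.coe_mul,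
      SubmonoidClass.coe_pow, toRees_C, toRees_X, Polynomial.monomial_pow, coe_monomialGens,
      MvPowerSeries.monomial_pow, Polynomial.C_mul_monomial,
      ← MvPowerSeries.monomial_zero_eq_C_apply, MvPowerSeries.monomial_mul_monomial]
    simp [exponent, Finsupp.single_apply, ite_smul]

/-- The presentation of the fiber cone of `I` by its monomial generators. -/
noncomputable def monomialPresentation (K : Type*) [Field K] :
    MvPolynomial (Fin 5) K →ₐ[K] FiberCone (I K) :=
  FiberCone.presentation K (I K) (monomialGens K)

theorem monomialPresentation_apply (K : Type*) [Field K] (h : MvPolynomial (Fin 5) K) :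
    monomialPresentation K h = Ideal.Quotient.mk _ (toRees K h) := by
  have : monomialPresentation K = (Ideal.Quotient.mkₐ K _).comp (toRees K) := by
    refine MvPolynomial.algHom_ext fun i => ?_
    simp [monomialPresentation, FiberCone.presentation, toRees, FiberCone.degOne]
  rw [this]
  rfl

theorem exists_le_of_coeff_mul_ne_zero {σ R : Type*} [CommSemiring R] {p q : MvPowerSeries σ R}
    {β : σ →₀ ℕ} (h : MvPowerSeries.coeff β (p * q) ≠ 0) :
    ∃ β₁ β₂, β₁ + β₂ = β ∧ MvPowerSeries.coeff β₁ p ≠ 0 ∧ MvPowerSeries.coeff β₂ q ≠ 0 := by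
  classical
  rw [MvPowerSeries.coeff_mul] at h
  obtain ⟨⟨β₁, β₂⟩, hβ, hne⟩ := Finset.exists_ne_zero_of_sum_ne_zero h
  exact ⟨β₁, β₂, Finset.HasAntidiagonal.mem_antidiagonal.mp hβ, left_ne_zero_of_mul hne,
    right_ne_zero_of_mul hne⟩

/-- Every monomial occurring in an element of `I` is divisible by a generator. -/
theorem exists_genExponent_le {K : Type*} [Field K] {h : A K} (hh : h ∈ I K) {β : Fin 2 →₀ ℕ}
    (hβ : MvPowerSeries.coeff β h ≠ 0) : ∃ i, genExponent i ≤ β := by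
  classical
  rw [I_eq_span_range] at hh
  induction hh using Submodule.span_induction generalizing β with
  | mem z hz =>
    obtain ⟨i, rfl⟩ := hz
    refine ⟨i, le_of_eq ?_⟩
    by_contra hne
    exact hβ (by simp only [coe_monomialGens]; rw [MvPowerSeries.coeff_monomial_ne (Ne.symm hne)])
  | zero => simp at hβ
  | add p q _ _ hp hq =>
    by_cases h0 : MvPowerSeries.coeff β p = 0
    · exact hq fun h1 => hβ (by rw [map_add, h0, h1, add_zero])
    · exact hp h0
  | smul r p _ hp =>
    obtain ⟨β₁, β₂, rfl, -, h2⟩ := exists_le_of_coeff_mul_ne_zero hβ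
    obtain ⟨i, hi⟩ := hp h2
    exact ⟨i, hi.trans le_add_self⟩

/-- Every monomial occurring in an element of `I ^ n` is divisible by a product of `n`
generators. -/
theorem exists_exponent_le {K : Type*} [Field K] {n : ℕ} {h : A K} (hh : h ∈ I K ^ n)
    {β : Fin 2 →₀ ℕ} (hβ : MvPowerSeries.coeff β h ≠ 0) :
    ∃ v : Fin 5 →₀ ℕ, v.degree = n ∧ exponent v ≤ β := by
  induction n generalizing h β with
  | zero => exact ⟨0, by simp, by simp [exponent]⟩
  | succ n ih =>
    rw [pow_succ'] at hh
    induction hh using Submodule.mul_induction_on' generalizing β with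
    | mem_mul_mem p hp q hq =>
      obtain ⟨β₁, β₂, rfl, h1, h2⟩ := exists_le_of_coeff_mul_ne_zero hβ
      obtain ⟨i, hi⟩ := exists_genExponent_le hp h1
      obtain ⟨v, rfl, hv⟩ := ih hq h2
      refine ⟨.single i 1 + v, by simp [add_comm], ?_⟩
      rw [exponent_add, exponent_single]
      exact add_le_add hi hv
    | add p _ q _ hp hq =>
      by_cases h0 : MvPowerSeries.coeff β p = 0
      · exact hq fun h1 => hβ (by rw [map_add, h0, h1, add_zero])
      · exact hp h0

/-- The monomials outside the ideal `(X₁X₃, X₁X₄, X₁X₅, X₂X₅, X₃X₅, X₂²X₄)`. -/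
def IsStandard (u : Fin 5 →₀ ℕ) : Prop :=
  (u 0 = 0 ∨ u 2 = 0) ∧ (u 0 = 0 ∨ u 3 = 0) ∧ (u 0 = 0 ∨ u 4 = 0) ∧ (u 1 = 0 ∨ u 4 = 0) ∧
    (u 2 = 0 ∨ u 4 = 0) ∧ (u 1 ≤ 1 ∨ u 3 = 0)

/-- A standard product of `n` generators is divisible by no other product of `n` generators. Write
`a, b, c, d, e` for the generators. For powers of two neighbours, this holds because `a, b, c, d, e`
are the consecutive vertices of the Newton polygon of `I`. For `b c ^ k d ^ l`, whose weight
`2i + j` exceeds the minimum, attained on the edge `cd`, by one, the only competitor is `y` times a product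
of powers of `c` and `d`, and there the exponent of `x` is even instead of odd. -/
theorem IsStandard.eq_of_exponent_le {u v : Fin 5 →₀ ℕ} (hu : IsStandard u)
    (hd : v.degree = u.degree) (h : exponent v ≤ exponent u) : v = u := by
  obtain ⟨h1, h2, h3, h4, h5, h6⟩ := hu
  have hx := h 0
  have hy := h 1
  rw [exponent_apply_zero, exponent_apply_zero] at hx
  rw [exponent_apply_one, exponent_apply_one] at hy
  rw [degree_eq_sum_five, degree_eq_sum_five] at hd
  have : v 0 = u 0 ∧ v 1 = u 1 ∧ v 2 = u 2 ∧ v 3 = u 3 ∧ v 4 = u 4 := by omega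
  ext i
  fin_cases i
  exacts [this.1, this.2.1, this.2.2.1, this.2.2.2.1, this.2.2.2.2]

theorem coeff_mem_of_mem_map {K : Type*} [Field K] {r : reesAlgebra (I K)}
    (hr : r ∈ (m K).map (algebraMap (A K) (reesAlgebra (I K)))) :
    ∀ n, (r : Polynomial (A K)).coeff n ∈ m K * I K ^ n := by
  induction hr using Submodule.span_induction with
  | mem z hz =>
    intro n
    obtain ⟨a, ha, rfl⟩ := hz
    change (Polynomial.C a).coeff n ∈ _
    rw [Polynomial.coeff_C]
    split_ifs with h0
    · subst h0
      simpa using ha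
    · exact zero_mem _
  | zero => simp
  | add p q _ _ hp hq => exact fun n => by simpa using add_mem (hp n) (hq n)
  | smul r p hp ih =>
    intro n
    rw [smul_eq_mul, MulMemClass.coe_mul, Polynomial.coeff_mul]
    refine sum_mem fun ij hij => ?_
    rw [← Finset.HasAntidiagonal.mem_antidiagonal.mp hij, pow_add, mul_left_comm]
    exact Ideal.mul_mem_mul (r.2 ij.1) (ih ij.2)

/-- The coefficient of a standard monomial in an element of `m * I ^ n` is zero. -/
theorem coeff_exponent_eq_zero {K : Type*} [Field K] {u : Fin 5 →₀ ℕ} (hu : IsStandard u) {h : A K}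
    (hh : h ∈ m K * I K ^ u.degree) : MvPowerSeries.coeff (exponent u) h = 0 := by
  induction hh using Submodule.mul_induction_on' with
  | mem_mul_mem p hp q hq =>
    by_contra hne
    obtain ⟨β₁, β₂, hβ, h1, h2⟩ := exists_le_of_coeff_mul_ne_zero hne
    obtain ⟨v, hv, hvβ⟩ := exists_exponent_le hq h2
    have hvu := hu.eq_of_exponent_le hv (hvβ.trans (hβ ▸ le_add_self))
    have : β₁ = 0 := by
      rw [hvu, ← hβ] at hvβ
      simpa using hvβ
    rw [this] at h1
    exact h1 ((mem_m_iff K p).mp hp)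
  | add p _ q _ hp hq => rw [map_add, hp, hq, add_zero]

theorem coeff_eq_zero_of_isStandard {K : Type*} [Field K] {h : MvPolynomial (Fin 5) K}
    (hh : monomialPresentation K h = 0) {u : Fin 5 →₀ ℕ} (hu : IsStandard u) :
    h.coeff u = 0 := by
  classical
  rw [monomialPresentation_apply, Ideal.Quotient.eq_zero_iff_mem] at hh
  have h0 := coeff_exponent_eq_zero hu (coeff_mem_of_mem_map hh u.degree)
  rw [← h0]
  have (v : Fin 5 →₀ ℕ) (c : K) : MvPowerSeries.coeff (exponent u)
      ((toRees K (MvPolynomial.monomial v c) : Polynomial (A K)).coeff u.degree) =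
        if v = u then c else 0 := by
    rw [toRees_monomial, Polynomial.coeff_monomial]
    split_ifs with h1 h2 h2
    · rw [h2, MvPowerSeries.coeff_monomial_same]
    · exact MvPowerSeries.coeff_monomial_ne
        (fun h3 => h2 (hu.eq_of_exponent_le h1 h3.ge)) c
    · exact absurd (by rw [h2]) h1
    · simp
  conv_rhs => rw [h.as_sum]
  simp only [map_sum, AddSubmonoidClass.coe_finsetSum, Polynomial.finsetSum_coeff, this]
  rw [Finset.sum_ite_eq']
  split_ifs with h1
  · rfl
  · exact MvPolynomial.notMem_support_iff.mp h1

/-- The ideal `(X₁X₃, X₁X₄, X₁X₅, X₂X₅, X₃X₅, X₂²X₄)`. -/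
noncomputable def monomialIdeal (K : Type*) [Field K] : Ideal (MvPolynomial (Fin 5) K) :=
  Ideal.span {MvPolynomial.X 0 * MvPolynomial.X 2, MvPolynomial.X 0 * MvPolynomial.X 3,
    MvPolynomial.X 0 * MvPolynomial.X 4, MvPolynomial.X 1 * MvPolynomial.X 4,
    MvPolynomial.X 2 * MvPolynomial.X 4, MvPolynomial.X 1 ^ 2 * MvPolynomial.X 3}

theorem monomial_mem_monomialIdeal {K : Type*} [Field K] {u : Fin 5 →₀ ℕ} (hu : ¬ IsStandard u)
    (c : K) : MvPolynomial.monomial u c ∈ monomialIdeal K := by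
  have dvd (i j : Fin 5) (p q : ℕ) (hij : i ≠ j) (hi : p ≤ u i) (hj : q ≤ u j) :
      (MvPolynomial.X i ^ p * MvPolynomial.X j ^ q : MvPolynomial (Fin 5) K) ∣
        MvPolynomial.monomial u c := by
    rw [MvPolynomial.X_pow_eq_monomial, MvPolynomial.X_pow_eq_monomial,
      MvPolynomial.monomial_mul, MvPolynomial.monomial_dvd_monomial]
    refine ⟨Or.inr fun k => ?_, by simp⟩
    rcases eq_or_ne k i with rfl | hki
    · simpa [hij] using hi
    · rcases eq_or_ne k j with rfl | hkj
      · simpa [hki] using hj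
      · simp [hki, hkj]
  have dvd₁ (i j : Fin 5) (hij : i ≠ j) (h : ¬ (u i = 0 ∨ u j = 0)) :
      (MvPolynomial.X i * MvPolynomial.X j : MvPolynomial (Fin 5) K) ∣
        MvPolynomial.monomial u c := by
    simpa using dvd i j 1 1 hij (by omega) (by omega)
  by_cases h1 : u 0 = 0 ∨ u 2 = 0
  swap
  · exact Ideal.mem_of_dvd _ (dvd₁ 0 2 (by decide) h1) (Ideal.subset_span (by simp))
  by_cases h2 : u 0 = 0 ∨ u 3 = 0
  swap
  · exact Ideal.mem_of_dvd _ (dvd₁ 0 3 (by decide) h2) (Ideal.subset_span (by simp))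
  by_cases h3 : u 0 = 0 ∨ u 4 = 0
  swap
  · exact Ideal.mem_of_dvd _ (dvd₁ 0 4 (by decide) h3) (Ideal.subset_span (by simp))
  by_cases h4 : u 1 = 0 ∨ u 4 = 0
  swap
  · exact Ideal.mem_of_dvd _ (dvd₁ 1 4 (by decide) h4) (Ideal.subset_span (by simp))
  by_cases h5 : u 2 = 0 ∨ u 4 = 0
  swap
  · exact Ideal.mem_of_dvd _ (dvd₁ 2 4 (by decide) h5) (Ideal.subset_span (by simp))
  have h6 : ¬ (u 1 ≤ 1 ∨ u 3 = 0) := fun h6 => hu ⟨h1, h2, h3, h4, h5, h6⟩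
  have h7 := dvd 1 3 2 1 (by decide) (by omega) (by omega)
  rw [pow_one] at h7
  exact Ideal.mem_of_dvd _ h7 (Ideal.subset_span (by simp))

theorem monomialPresentation_eq_zero {K : Type*} [Field K] {h h' : MvPolynomial (Fin 5) K} {a : A K}
    (ha : a ∈ m K) (hh : (toRees K h : Polynomial (A K)) =
      Polynomial.C a * (toRees K h' : Polynomial (A K))) :
    monomialPresentation K h = 0 := by
  rw [monomialPresentation_apply, Ideal.Quotient.eq_zero_iff_mem]
  have : toRees K h = algebraMap (A K) (reesAlgebra (I K)) a * toRees K h' := Subtype.ext hh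
  rw [this]
  exact Ideal.mul_mem_right _ _ (Ideal.mem_map_of_mem _ ha)

/-- The six monomial relations come from the identities
`ac = x b²`, `ad = y³ bc`, `ae = y⁵ bd`, `be = xy d²`, `ce = y² d²`, `b² d = y² c³`
between the generators `a, b, c, d, e` of `I`. -/
theorem ker_monomialPresentation (K : Type*) [Field K] :
    RingHom.ker (monomialPresentation K) = monomialIdeal K := by
  refine le_antisymm (fun h hh => ?_) ?_
  · rw [h.as_sum]
    refine sum_mem fun u hu => monomial_mem_monomialIdeal (fun hs => ?_) _
    exact MvPolynomial.mem_support_iff.mp hu (coeff_eq_zero_of_isStandard hh hs)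
  · rw [monomialIdeal, Ideal.span_le]
    have hx := x_mem_m K
    have hy (n : ℕ) : y K ^ (n + 1) ∈ m K := Ideal.pow_mem_of_mem _ (y_mem_m K) _ n.succ_pos
    have hxy := (m K).mul_mem_right (y K) hx
    have aux {i j k l : Fin 5} {a : A K} (ha : a ∈ m K)
        (h : (monomialGens K i * monomialGens K j : A K) =
          a * (monomialGens K k * monomialGens K l)) :
        MvPolynomial.X i * MvPolynomial.X j ∈ RingHom.ker (monomialPresentation K) := by
      refine monomialPresentation_eq_zero ha (h' := MvPolynomial.X k * MvPolynomial.X l) ?_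
      rw [map_mul, map_mul, MulMemClass.coe_mul, MulMemClass.coe_mul, toRees_X, toRees_X,
        toRees_X, toRees_X, Polynomial.monomial_mul_monomial, Polynomial.monomial_mul_monomial,
        Polynomial.C_mul_monomial, h]
    rintro _ (rfl | rfl | rfl | rfl | rfl | rfl)
    · exact aux hx (k := 1) (l := 1) (by simp only [monomialGens, Matrix.cons_val]; ring)
    · exact aux (hy 2) (k := 1) (l := 2) (by simp only [monomialGens, Matrix.cons_val]; ring)
    · exact aux (hy 4) (k := 1) (l := 3) (by simp only [monomialGens, Matrix.cons_val]; ring)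
    · exact aux hxy (k := 3) (l := 3) (by simp only [monomialGens, Matrix.cons_val]; ring)
    · exact aux (hy 1) (k := 3) (l := 3) (by simp only [monomialGens, Matrix.cons_val]; ring)
    · refine monomialPresentation_eq_zero (hy 1) (h' := MvPolynomial.X 2 ^ 3) ?_
      rw [map_mul, map_pow (toRees K), map_pow (toRees K), MulMemClass.coe_mul,
        SubmonoidClass.coe_pow, SubmonoidClass.coe_pow, toRees_X, toRees_X, toRees_X,
        Polynomial.monomial_pow, Polynomial.monomial_pow, Polynomial.monomial_mul_monomial,
        Polynomial.C_mul_monomial]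
      congr 1
      simp only [monomialGens, Matrix.cons_val]
      ring

/-! ### The kernel of `φ` -/

/-- The linear change of variables that expresses `f, g, x ^ 7, x ^ 2 * y ^ 6, y ^ 12` through the
monomial generators of `I`. -/
noncomputable def toMonomialVars (K : Type*) [Field K] :
    MvPolynomial (Fin 5) K →ₐ[K] MvPolynomial (Fin 5) K :=
  MvPolynomial.aeval ![.X 0 + .X 2 + .X 4, .X 1 + .X 3, .X 0, .X 3, .X 4]

/-- The inverse of `toMonomialVars`. -/
noncomputable def ofMonomialVars (K : Type*) [Field K] :
    MvPolynomial (Fin 5) K →ₐ[K] MvPolynomial (Fin 5) K :=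
  MvPolynomial.aeval ![.X 2, .X 1 - .X 3, .X 0 - .X 2 - .X 4, .X 3, .X 4]

theorem ofMonomialVars_toMonomialVars (K : Type*) [Field K] (h : MvPolynomial (Fin 5) K) :
    ofMonomialVars K (toMonomialVars K h) = h := by
  have : (ofMonomialVars K).comp (toMonomialVars K) = AlgHom.id K _ := by
    refine MvPolynomial.algHom_ext fun i => ?_
    fin_cases i <;> simp [ofMonomialVars, toMonomialVars]
    ring
  exact DFunLike.congr_fun this h

theorem toMonomialVars_ofMonomialVars (K : Type*) [Field K] (h : MvPolynomial (Fin 5) K) :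
    toMonomialVars K (ofMonomialVars K h) = h := by
  have : (toMonomialVars K).comp (ofMonomialVars K) = AlgHom.id K _ := by
    refine MvPolynomial.algHom_ext fun i => ?_
    fin_cases i <;> simp [ofMonomialVars, toMonomialVars]
    ring
  exact DFunLike.congr_fun this h

theorem degOne_add {R : Type*} [CommRing R] [IsLocalRing R] (J : Ideal R) (a b : J) :
    FiberCone.degOne J (a + b) = FiberCone.degOne J a + FiberCone.degOne J b := by
  rw [FiberCone.degOne, FiberCone.degOne, FiberCone.degOne, ← map_add]
  congr 1
  exact Subtype.ext (map_add (Polynomial.monomial 1) (a : R) b)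

theorem φ_apply (K : Type*) [Field K] (h : MvPolynomial (Fin 5) K) :
    φ K h = monomialPresentation K (toMonomialVars K h) := by
  have : φ K = (monomialPresentation K).comp (toMonomialVars K) := by
    refine MvPolynomial.algHom_ext fun i => ?_
    fin_cases i <;>
      simp [φ, monomialPresentation, FiberCone.presentation, toMonomialVars, gens, monomialGens,
        ← degOne_add, f, g]
  rw [this]
  rfl

/-- The ideal generated by the six claimed relations between `X₁, …, X₅`. -/
noncomputable def kerIdeal (K : Type*) [Field K] : Ideal (MvPolynomial (Fin 5) K) :=
  Ideal.span {
    MvPolynomial.X 2 ^ 2 - MvPolynomial.X 0 * MvPolynomial.X 2,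
    MvPolynomial.X 2 * MvPolynomial.X 3,
    MvPolynomial.X 2 * MvPolynomial.X 4,
    MvPolynomial.X 3 * MvPolynomial.X 4 - MvPolynomial.X 1 * MvPolynomial.X 4,
    MvPolynomial.X 4 ^ 2 - MvPolynomial.X 0 * MvPolynomial.X 4,
    MvPolynomial.X 3 ^ 3 + MvPolynomial.X 1 ^ 2 * MvPolynomial.X 3 -
      2 * MvPolynomial.X 1 * MvPolynomial.X 3 ^ 2}

theorem kerIdeal_le_ker_iff {K : Type*} [Field K] {T : Type*} [CommRing T] [Algebra K T]
    (χ : MvPolynomial (Fin 5) K →ₐ[K] T) {f g a d e : T} (hf : χ (.X 0) = f) (hg : χ (.X 1) = g)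
    (ha : χ (.X 2) = a) (hd : χ (.X 3) = d) (he : χ (.X 4) = e) :
    kerIdeal K ≤ RingHom.ker χ ↔ a ^ 2 = f * a ∧ a * d = 0 ∧ a * e = 0 ∧ d * e = g * e ∧
      e ^ 2 = f * e ∧ d ^ 3 + g ^ 2 * d - 2 * g * d ^ 2 = 0 := by
  rw [kerIdeal, Ideal.span_le]
  have h2 : χ 2 = 2 := map_ofNat χ 2
  simp [Set.insert_subset_iff, RingHom.mem_ker, hf, hg, ha, hd, he, h2, sub_eq_zero]

/-- The change of variables carries the monomial ideal of `ker_monomialPresentation` to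
`kerIdeal`. -/
theorem ker_φ (K : Type*) [Field K] : RingHom.ker (φ K) = kerIdeal K := by
  refine le_antisymm (fun h hh => ?_) ?_
  · have h1 : toMonomialVars K h ∈ monomialIdeal K := by
      rw [← ker_monomialPresentation]
      rwa [RingHom.mem_ker, φ_apply] at hh
    suffices monomialIdeal K ≤ (kerIdeal K).comap (ofMonomialVars K) by
      have h2 := this h1
      rwa [Ideal.mem_comap, ofMonomialVars_toMonomialVars] at h2
    let π := Ideal.Quotient.mkₐ K (kerIdeal K)
    obtain ⟨aa, ad, ae, de, ee, ddd⟩ := (kerIdeal_le_ker_iff π rfl rfl rfl rfl rfl).mp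
      (fun p hp => Ideal.Quotient.eq_zero_iff_mem.mpr hp)
    have hmem (p : MvPolynomial (Fin 5) K) (hp : π (ofMonomialVars K p) = 0) :
        p ∈ (kerIdeal K).comap (ofMonomialVars K) :=
      Ideal.mem_comap.mpr (Ideal.Quotient.eq_zero_iff_mem.mp hp)
    rw [monomialIdeal, Ideal.span_le]
    rintro _ (rfl | rfl | rfl | rfl | rfl | rfl) <;> refine hmem _ ?_ <;>
      simp only [ofMonomialVars, map_mul, map_pow, MvPolynomial.aeval_X, Matrix.cons_val, map_sub]
    · linear_combination -aa - ae
    · linear_combination ad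
    · linear_combination ae
    · linear_combination -de
    · linear_combination -ee - ae
    · linear_combination ddd
  · let π := (Ideal.Quotient.mkₐ K (monomialIdeal K))
    have hπ {p : MvPolynomial (Fin 5) K} (hp : p ∈ monomialIdeal K) : π p = 0 :=
      Ideal.Quotient.eq_zero_iff_mem.mpr hp
    have ac : π (.X 0) * π (.X 2) = 0 := by
      rw [← map_mul]; exact hπ (Ideal.subset_span (by simp))
    have ad : π (.X 0) * π (.X 3) = 0 := by
      rw [← map_mul]; exact hπ (Ideal.subset_span (by simp))
    have ae : π (.X 0) * π (.X 4) = 0 := by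
      rw [← map_mul]; exact hπ (Ideal.subset_span (by simp))
    have be : π (.X 1) * π (.X 4) = 0 := by
      rw [← map_mul]; exact hπ (Ideal.subset_span (by simp))
    have ce : π (.X 2) * π (.X 4) = 0 := by
      rw [← map_mul]; exact hπ (Ideal.subset_span (by simp))
    have bbd : π (.X 1) ^ 2 * π (.X 3) = 0 := by
      rw [← map_pow, ← map_mul]; exact hπ (Ideal.subset_span (by simp))
    have key : kerIdeal K ≤ RingHom.ker (π.comp (toMonomialVars K)) := by
      refine (kerIdeal_le_ker_iff _ (f := π (.X 0) + π (.X 2) + π (.X 4))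
        (g := π (.X 1) + π (.X 3)) (a := π (.X 0)) (d := π (.X 3)) (e := π (.X 4))
        (by simp [toMonomialVars]) (by simp [toMonomialVars]) (by simp [toMonomialVars])
        (by simp [toMonomialVars]) (by simp [toMonomialVars])).mpr
        ⟨?_, ad, ae, ?_, ?_, ?_⟩
      · linear_combination -ac - ae
      · linear_combination -be
      · linear_combination -ae - ce
      · linear_combination bbd
    intro h hh
    rw [RingHom.mem_ker, φ_apply, ← RingHom.mem_ker, ker_monomialPresentation]
    exact Ideal.Quotient.eq_zero_iff_mem.mp (key hh)

/-! ### The fiber cone as a free module over `K[f, g]` -/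

theorem mk_algebraMap_mem_range (K : Type*) [Field K] (r : A K) :
    (Ideal.Quotient.mk _ (algebraMap (A K) (reesAlgebra (I K)) r) : FiberCone (I K)) ∈
      (monomialPresentation K).range := by
  refine ⟨.C (MvPowerSeries.constantCoeff r), ?_⟩
  change monomialPresentation K _ = _
  rw [monomialPresentation_apply, Ideal.Quotient.eq]
  have : toRees K (.C (MvPowerSeries.constantCoeff r)) =
      algebraMap (A K) (reesAlgebra (I K)) (MvPowerSeries.C (MvPowerSeries.constantCoeff r)) :=
    Subtype.ext (toRees_C K _)
  rw [this, ← map_sub]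
  exact Ideal.mem_map_of_mem _ ((mem_m_iff K _).mpr (by simp))

theorem degOne_mem_range {K : Type*} [Field K] (z : I K) :
    FiberCone.degOne (I K) z ∈ (monomialPresentation K).range := by
  obtain ⟨z, hz⟩ := z
  have key : z ∈ Ideal.span (Set.range fun i => (monomialGens K i : A K)) :=
    (I_eq_span_range K).le hz
  induction key using Submodule.span_induction with
  | mem z h =>
    obtain ⟨i, rfl⟩ := h
    exact ⟨.X i, by simp [monomialPresentation, FiberCone.presentation]⟩
  | zero =>
    have h := degOne_add (I K) 0 0
    rw [add_zero, left_eq_add] at h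
    exact (congrArg (· ∈ (monomialPresentation K).range) h).mpr (zero_mem _)
  | add p q hp hq ihp ihq =>
    have hp' := (I_eq_span_range K).ge hp
    have hq' := (I_eq_span_range K).ge hq
    have := degOne_add (I K) ⟨p, hp'⟩ ⟨q, hq'⟩
    exact (congrArg (· ∈ (monomialPresentation K).range) this).mpr (add_mem (ihp hp') (ihq hq'))
  | smul a p hp ih =>
    have hp' := (I_eq_span_range K).ge hp
    have : FiberCone.degOne (I K) ⟨a • p, hz⟩ =
        Ideal.Quotient.mk _ (algebraMap (A K) (reesAlgebra (I K)) a) *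
          FiberCone.degOne (I K) ⟨p, hp'⟩ := by
      rw [FiberCone.degOne, FiberCone.degOne, ← map_mul]
      congr 1
      exact Subtype.ext (Polynomial.C_mul_monomial (n := 1) (a := a) (b := p)).symm
    rw [this]
    exact mul_mem (mk_algebraMap_mem_range K a) (ih hp')

/-- The fiber cone is generated over `K` in degree one, since the residue field of `K[[x, y]]`
is `K`. -/
theorem monomialPresentation_surjective (K : Type*) [Field K] :
    Function.Surjective (monomialPresentation K) := by
  have key (r : Polynomial (A K))
      (hr : r ∈ Algebra.adjoin (A K) (Submodule.map
        (Polynomial.monomial 1 : A K →ₗ[A K] Polynomial (A K)) (I K) : Set (Polynomial (A K)))) :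
      ∀ h : r ∈ reesAlgebra (I K),
        (Ideal.Quotient.mk _ ⟨r, h⟩ : FiberCone (I K)) ∈ (monomialPresentation K).range := by
    induction hr using Algebra.adjoin_induction with
    | mem z hz =>
      obtain ⟨z, hz, rfl⟩ := hz
      exact fun _ => degOne_mem_range ⟨z, hz⟩
    | algebraMap a => exact fun h => mk_algebraMap_mem_range K a
    | add p q hp hq ihp ihq =>
      intro h
      rw [adjoin_monomial_eq_reesAlgebra] at hp hq
      exact add_mem (ihp hp) (ihq hq)
    | mul p q hp hq ihp ihq =>
      intro h
      rw [adjoin_monomial_eq_reesAlgebra] at hp hq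
      exact mul_mem (ihp hp) (ihq hq)
  intro z
  obtain ⟨r, rfl⟩ := Ideal.Quotient.mk_surjective z
  exact key r (by rw [adjoin_monomial_eq_reesAlgebra]; exact r.2) r.2

theorem φ_surjective (K : Type*) [Field K] : Function.Surjective (φ K) := fun z => by
  obtain ⟨h, rfl⟩ := monomialPresentation_surjective K z
  exact ⟨ofMonomialVars K h, by rw [φ_apply, toMonomialVars_ofMonomialVars]⟩

open Polynomial in
/-- Substitution of `s` for `X` and `t` for `Y` in polynomials of `K[X][Y]`. -/
noncomputable def evalPair {K : Type*} [Field K] {T : Type*} [CommRing T] [Algebra K T] (s t : T) :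
    K[X][X] →ₐ[K] T :=
  aevalTower (aeval s) t

open Polynomial in
theorem evalPair_C_X {K : Type*} [Field K] {T : Type*} [CommRing T] [Algebra K T] (s t : T) :
    evalPair (K := K) s t (C X) = s := by
  simp [evalPair]

open Polynomial in
theorem evalPair_X {K : Type*} [Field K] {T : Type*} [CommRing T] [Algebra K T] (s t : T) :
    evalPair (K := K) s t X = t := by
  simp [evalPair]

open Polynomial in
theorem evalPair_unique {K : Type*} [Field K] {T : Type*} [CommRing T] [Algebra K T]
    (χ : K[X][X] →ₐ[K] T) : evalPair (χ (C X)) (χ X) = χ := by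
  refine Polynomial.algHom_ext' (Polynomial.algHom_ext ?_) (evalPair_X _ _)
  exact evalPair_C_X _ _

/-- Lifts to `K[X₁, …, X₅]` of the basis `1, a, d, e, d ^ 2` of the fiber cone over `K[f, g]`,
where `a, d, e` are the classes of `x ^ 7, x ^ 2 * y ^ 6, y ^ 12`. -/
noncomputable def basisLift (K : Type*) [Field K] : Fin 5 → MvPolynomial (Fin 5) K :=
  ![1, .X 2, .X 3, .X 4, .X 3 ^ 2]

open Polynomial in
/-- Here and below the fiber cone is replaced by any ring `F` presented as `K[X₁, …, X₅]` modulo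
`kerIdeal`, with `K[X][Y]` acting through `X ↦ f` and `Y ↦ g`. -/
theorem span_basisLift {K F : Type*} [Field K] [CommRing F] [Algebra K F] [Algebra K[X][X] F]
    {φ : MvPolynomial (Fin 5) K →ₐ[K] F} (hsurj : Function.Surjective φ)
    (hker : RingHom.ker φ = kerIdeal K)
    (halg : ∀ p, algebraMap K[X][X] F p = φ (evalPair (.X 0) (.X 1) p)) :
    Submodule.span K[X][X] (Set.range fun i => φ (basisLift K i)) = ⊤ := by
  set N := Submodule.span K[X][X] (Set.range fun i => φ (basisLift K i)) with hN
  obtain ⟨aa, ad, ae, de, ee, ddd⟩ := (kerIdeal_le_ker_iff φ rfl rfl rfl rfl rfl).mp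
    hker.ge
  set f := φ (.X 0)
  set g := φ (.X 1)
  set a := φ (.X 2)
  set d := φ (.X 3)
  set e := φ (.X 4)
  have hf {z : F} (hz : z ∈ N) : f * z ∈ N := by
    have := N.smul_mem (C X) hz
    rwa [Algebra.smul_def, halg, evalPair_C_X] at this
  have hg {z : F} (hz : z ∈ N) : g * z ∈ N := by
    have := N.smul_mem X hz
    rwa [Algebra.smul_def, halg, evalPair_X] at this
  have h1 : 1 ∈ N := Submodule.subset_span ⟨0, by simp [basisLift]⟩
  have ha : a ∈ N := Submodule.subset_span ⟨1, by simp [basisLift, a]⟩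
  have hd : d ∈ N := Submodule.subset_span ⟨2, by simp [basisLift, d]⟩
  have he : e ∈ N := Submodule.subset_span ⟨3, by simp [basisLift, e]⟩
  have hdd : d ^ 2 ∈ N := Submodule.subset_span ⟨4, by simp [basisLift, d]⟩
  -- A generator of the fiber cone maps the spanning set into `N`, by the six relations.
  have mul_mem (r : F) (hr : r * 1 ∈ N ∧ r * a ∈ N ∧ r * d ∈ N ∧ r * e ∈ N ∧
      r * d ^ 2 ∈ N) (z : F) (hz : z ∈ N) : z * r ∈ N := by
    induction hz using Submodule.span_induction with
    | mem z hz =>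
      obtain ⟨h1, h2, h3, h4, h5⟩ := hr
      obtain ⟨i, rfl⟩ := hz
      rw [mul_comm]
      fin_cases i
      exacts [by simpa [basisLift] using h1, by simpa [basisLift] using h2,
        by simpa [basisLift] using h3, by simpa [basisLift] using h4,
        by simpa [basisLift] using h5]
    | zero => simp
    | add p q _ _ hp hq => rw [add_mul]; exact add_mem hp hq
    | smul c p _ hp => rw [smul_mul_assoc]; exact N.smul_mem c hp
  refine eq_top_iff.mpr fun z _ => ?_
  obtain ⟨h, rfl⟩ := hsurj z
  induction h using MvPolynomial.induction_on with
  | C c =>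
    have := N.smul_mem (C (C c)) h1
    rw [Algebra.smul_def, mul_one, halg] at this
    simpa [evalPair] using this
  | add p q hp hq => rw [map_add]; exact add_mem (hp trivial) (hq trivial)
  | mul_X p i hp =>
    rw [map_mul]
    refine mul_mem _ ?_ _ (hp trivial)
    have d3 : d * d ^ 2 = 2 * (g * d ^ 2) - g * (g * d) := by linear_combination ddd
    have two (z : F) (hz : z ∈ N) : 2 * z ∈ N := by
      rw [two_mul]; exact add_mem hz hz
    fin_cases i
    · change f * 1 ∈ N ∧ f * a ∈ N ∧ f * d ∈ N ∧ f * e ∈ N ∧ f * d ^ 2 ∈ N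
      exact ⟨hf h1, hf ha, hf hd, hf he, hf hdd⟩
    · change g * 1 ∈ N ∧ g * a ∈ N ∧ g * d ∈ N ∧ g * e ∈ N ∧ g * d ^ 2 ∈ N
      exact ⟨hg h1, hg ha, hg hd, hg he, hg hdd⟩
    · change a * 1 ∈ N ∧ a * a ∈ N ∧ a * d ∈ N ∧ a * e ∈ N ∧ a * d ^ 2 ∈ N
      refine ⟨by simpa, ?_, ?_, ?_, ?_⟩
      · convert hf ha using 1; linear_combination aa
      · convert N.zero_mem using 1
      · convert N.zero_mem using 1
      · convert N.zero_mem using 1; linear_combination d * ad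
    · change d * 1 ∈ N ∧ d * a ∈ N ∧ d * d ∈ N ∧ d * e ∈ N ∧ d * d ^ 2 ∈ N
      refine ⟨by simpa, ?_, ?_, ?_, ?_⟩
      · convert N.zero_mem using 1; linear_combination ad
      · convert hdd using 1; exact (pow_two d).symm
      · convert hg he using 1
      · exact d3 ▸ sub_mem (two _ (hg hdd)) (hg (hg hd))
    · change e * 1 ∈ N ∧ e * a ∈ N ∧ e * d ∈ N ∧ e * e ∈ N ∧ e * d ^ 2 ∈ N
      refine ⟨by simpa, ?_, ?_, ?_, ?_⟩
      · convert N.zero_mem using 1; linear_combination ae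
      · convert hg he using 1; linear_combination de
      · convert hf he using 1; linear_combination ee
      · convert hg (hg he) using 1; linear_combination (d + g) * de

open Polynomial in
/-- A point `(f, g, a, d, e)` of the fiber cone with values in a `K`-algebra `T`, with `(f, g)` the
image of `(X, Y)` under `χ`, turns a linear relation over `K[f, g]` between `1, a, d, e, d ^ 2` into
one over `T`. -/
theorem relation_of_point {K F T : Type*} [Field K] [CommRing F] [Algebra K F] [CommRing T]
    [Algebra K T] {φ : MvPolynomial (Fin 5) K →ₐ[K] F} (hker : RingHom.ker φ = kerIdeal K)
    {p : Fin 5 → K[X][X]}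
    (hp : φ (∑ i, evalPair (.X 0) (.X 1) (p i) * basisLift K i) = 0)
    (χ : K[X][X] →ₐ[K] T) {a d e : T} (haa : a ^ 2 = χ (C X) * a) (had : a * d = 0)
    (hae : a * e = 0) (hde : d * e = χ X * e) (hee : e ^ 2 = χ (C X) * e)
    (hddd : d ^ 3 + χ X ^ 2 * d - 2 * χ X * d ^ 2 = 0) :
    χ (p 0) + χ (p 1) * a + χ (p 2) * d + χ (p 3) * e + χ (p 4) * d ^ 2 = 0 := by
  let ψ : MvPolynomial (Fin 5) K →ₐ[K] T := MvPolynomial.aeval ![χ (C X), χ X, a, d, e]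
  have hψ : kerIdeal K ≤ RingHom.ker ψ :=
    (kerIdeal_le_ker_iff ψ (by simp [ψ]) (by simp [ψ]) (by simp [ψ]) (by simp [ψ])
      (by simp [ψ])).mpr ⟨haa, had, hae, hde, hee, hddd⟩
  have hχ (q : K[X][X]) : ψ (evalPair (.X 0) (.X 1) q) = χ q := by
    change (ψ.comp (evalPair (.X 0) (.X 1))) q = χ q
    congr 1
    rw [← evalPair_unique χ, ← evalPair_unique (ψ.comp _)]
    simp [evalPair_C_X, evalPair_X, ψ]
  have h0 : ψ (∑ i, evalPair (.X 0) (.X 1) (p i) * basisLift K i) = 0 :=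
    hψ (hker.le hp)
  rw [map_sum] at h0
  simp only [map_mul, hχ, Fin.sum_univ_five] at h0
  simpa [basisLift, ψ] using h0

open Polynomial in
/-- The independence is tested on four points of the fiber cone, coming from the edges `ab`, `bc`,
`cd`, `de` of the Newton polygon of `I`. Over the edge `cd` the class of `b` is nonzero with
square zero, hence the dual numbers. -/
theorem linearIndependent_basisLift {K F : Type*} [Field K] [CommRing F] [Algebra K F]
    [Algebra K[X][X] F]
    {φ : MvPolynomial (Fin 5) K →ₐ[K] F} (hker : RingHom.ker φ = kerIdeal K)
    (halg : ∀ p, algebraMap K[X][X] F p = φ (evalPair (.X 0) (.X 1) p)) :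
    LinearIndependent K[X][X] fun i => φ (basisLift K i) := by
  rw [Fintype.linearIndependent_iff]
  intro p hp
  replace hp : φ (∑ i, evalPair (.X 0) (.X 1) (p i) * basisLift K i) = 0 := by
    rw [← hp, map_sum]
    exact Finset.sum_congr rfl fun i _ => by
      rw [map_mul, Algebra.smul_def, halg]
  have hX : (C X : K[X][X]) ≠ 0 := C_ne_zero.mpr X_ne_zero
  -- The edge `bc`, where `a = d = e = 0`.
  have p0 : p 0 = 0 := by
    have := relation_of_point hker hp (AlgHom.id K K[X][X]) (a := 0) (d := 0) (e := 0)
      (by simp) (by simp) (by simp) (by simp) (by simp) (by simp)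
    simpa using this
  -- The edge `ab`, where `f = a` and `d = e = 0`.
  have p1 : p 1 = 0 := by
    have := relation_of_point hker hp (AlgHom.id K K[X][X]) (a := C X) (d := 0) (e := 0)
      (by simp [pow_two]) (by simp) (by simp) (by simp) (by simp) (by simp)
    simpa [p0, hX] using this
  -- The edge `cd` with `b = ε`, where `g = d + ε` and `a = e = 0`.
  have p24 := relation_of_point (T := DualNumber K[X][X]) hker hp
    (IsScalarTower.toAlgHom K K[X][X] (DualNumber K[X][X]))
      (a := 0) (d := algebraMap K[X][X] _ X - DualNumber.eps) (e := 0)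
      (by simp) (by simp) (by simp) (by simp) (by simp) (by
        have : (DualNumber.eps : DualNumber K[X][X]) ^ 2 = 0 := by
          rw [pow_two, DualNumber.eps_mul_eps]
        simp only [IsScalarTower.coe_toAlgHom']
        linear_combination (algebraMap K[X][X] (DualNumber K[X][X]) X - DualNumber.eps) * this)
  have fst : p 2 * X + p 4 * X ^ 2 = 0 := by
    simpa [p0, p1, TrivSqZeroExt.algebraMap_eq_inl] using congrArg TrivSqZeroExt.fst p24
  have snd : p 2 * -1 + p 4 * (2 * (X * -1)) = 0 := by
    simpa [p0, p1, TrivSqZeroExt.algebraMap_eq_inl] using congrArg TrivSqZeroExt.snd p24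
  have p4 : p 4 = 0 := by
    have : p 4 * X ^ 2 = 0 := by linear_combination -fst - X * snd
    exact (mul_eq_zero.mp this).resolve_right (pow_ne_zero 2 X_ne_zero)
  have p2 : p 2 = 0 := by simpa [p4] using snd
  -- The edge `de`, where `f = e`, `g = d` and `a = 0`.
  have p3 : p 3 = 0 := by
    have := relation_of_point hker hp (AlgHom.id K K[X][X]) (a := 0) (d := X) (e := C X)
      (by simp) (by simp) (by simp) (by simp) (by simp [pow_two]) (by simp; ring)
    simpa [p0, p2, p4, hX] using this
  intro i
  fin_cases i
  exacts [p0, p1, p2, p3, p4]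

open Polynomial in
/-- The ring `K[X₁, …, X₅]` modulo `kerIdeal` is free over `K[f, g]`, hence Cohen-Macaulay. -/
theorem isCohenMacaulayRing_of_ker_eq {K F : Type*} [Field K] [CommRing F] [Algebra K F]
    {φ : MvPolynomial (Fin 5) K →ₐ[K] F} (hsurj : Function.Surjective φ)
    (hker : RingHom.ker φ = kerIdeal K) : IsCohenMacaulayRing F := by
  let χ : K[X][X] →ₐ[K] F := φ.comp (evalPair (.X 0) (.X 1))
  let := χ.toRingHom.toAlgebra
  have halg (p : K[X][X]) : algebraMap K[X][X] F p = φ (evalPair (.X 0) (.X 1) p) := rfl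
  let b := Module.Basis.mk (linearIndependent_basisLift hker halg)
    (span_basisLift hsurj hker halg).ge
  have : Module.Free K[X][X] F := Module.Free.of_basis b
  have : Module.Finite K[X][X] F := Module.Finite.of_basis b
  exact isCohenMacaulayRing_of_finite_of_flat K F

end FiberConeExample

theorem mainTheorem5 (K : Type*) [Field K] :
    -- (i)
    ((FiberConeExample.Q K).IsReductionOf (FiberConeExample.I K) ∧
      FiberConeExample.I K ^ 2 = FiberConeExample.Q K * FiberConeExample.I K +
        Ideal.span {FiberConeExample.x K ^ 4 * FiberConeExample.y K ^ 12} ∧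
      FiberConeExample.I K ^ 3 = FiberConeExample.Q K * FiberConeExample.I K ^ 2) ∧
    -- (ii)
    (FiberConeExample.m K * FiberConeExample.I K ^ 2 =
        FiberConeExample.m K * FiberConeExample.Q K * FiberConeExample.I K ∧
      IsCohenMacaulayRing (FiberCone (FiberConeExample.I K))) ∧
    -- (iii), where `X₁, …, X₅` are `X 0, …, X 4`
    (RingHom.ker (FiberConeExample.φ K) =
      Ideal.span {
        MvPolynomial.X 2 ^ 2 - MvPolynomial.X 0 * MvPolynomial.X 2,
        MvPolynomial.X 2 * MvPolynomial.X 3,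
        MvPolynomial.X 2 * MvPolynomial.X 4,
        MvPolynomial.X 3 * MvPolynomial.X 4 - MvPolynomial.X 1 * MvPolynomial.X 4,
        MvPolynomial.X 4 ^ 2 - MvPolynomial.X 0 * MvPolynomial.X 4,
        MvPolynomial.X 3 ^ 3 + MvPolynomial.X 1 ^ 2 * MvPolynomial.X 3 -
          2 * MvPolynomial.X 1 * MvPolynomial.X 3 ^ 2}) :=
  ⟨⟨⟨FiberConeExample.Q_le_I K, 2, two_pos, FiberConeExample.I_cube_eq K⟩,
    FiberConeExample.I_sq_eq K, FiberConeExample.I_cube_eq K⟩,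
    ⟨FiberConeExample.m_mul_I_sq_eq K, FiberConeExample.isCohenMacaulayRing_of_ker_eq
      (FiberConeExample.φ_surjective K) (FiberConeExample.ker_φ K)⟩,
    FiberConeExample.ker_φ K⟩
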